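/- Let $\Gamma$ be a finite digraph without loops. For vertices $x,y$ let $\partial_\Gamma(x,y)$ be the length of a shortest directed path from $x$ to $y$, let $\tilde\partial_\Gamma(x,y)=(\partial_\Gamma(x,y),\partial_\Gamma(y,x))$ be the two-way distance, let $\tilde\partial(\Gamma)=\{\tilde\partial_\Gamma(x,y)\mid x,y\in V(\Gamma)\}$, and for $\tilde i\in\tilde\partial(\Gamma)$ put $\Gamma_{\tilde i}=\{(x,y)\mid\tilde\partial_\Gamma(x,y)=\tilde i\}$. Assume that $\Gamma$ is a commutative weakly distance-regular digraph, i.e. $\Gamma$ is strongly connected and $(V(\Gamma),\{\Gamma_{\tilde i}\}_{\tilde i\in\tilde\partial(\Gamma)})$ is a non-symmetric commutative association scheme. Let $\Sigma$ be the underlying graph of $\Gamma$ (distinct $x,y$ are adjacent if and only if $(x,y)$ or $(y,x)$ is an arc of $\Gamma$). Assume that, up to isomorphism, either $\Sigma$ is the Johnson graph $J(m,e)$ with $e\ge 2$ and $m\ge 2e$ (vertices: the $e$-subsets of an $m$-set; $x,y$ adjacent when $|x\cap y|=e-1$), or $\Sigma$ is the folded Johnson graph $\bar J(2e,e)$ with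 $e\ge 4$ and $m=2e$ (vertices: the partitions of a $2e$-set into two $e$-sets; the partitions containing the $e$-sets $x$ and $y$ respectively are adjacent when $|x\cap y|\in\{1,e-1\}$). Let $T=\{q+1\mid(1,q)\in\tilde\partial(\Gamma)\}$. If $T=\{3\}$, i.e. if every arc $(x,y)$ of $\Gamma$ satisfies $\partial_\Gamma(y,x)=2$, then $\Sigma$ is isomorphic to the Johnson graph $J(m,2)$. In particular, $\Sigma$ is not isomorphic to any Johnson graph $J(n',e')$ with $e'>2$ and $n'\ge 2e'$, nor to any folded Johnson graph $\bar J(2e',e')$ with $e'\ge 4$. -/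

import Mathlib

namespace WDRD

/-! ### Association schemes -/

section Scheme

variable {X I : Type*}

/-- The number of `z` with `(x, z) ∈ R i` and `(z, y) ∈ R j`. -/
noncomputable def interCount (R : I → Set (X × X)) (i j : I) (x y : X) : ℕ :=
  {z : X | (x, z) ∈ R i ∧ (z, y) ∈ R j}.ncard

/-- The family of relations `R` on the (finite) set `X` is an association scheme. -/
structure IsAssociationScheme (R : I → Set (X × X)) : Prop where
  nonempty : ∀ i, (R i).Nonempty
  diagonal : ∃ i, R i = {p | p.1 = p.2}
  partition : ∀ p : X × X, ∃! i, p ∈ R i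
  transpose : ∀ i, ∃ i', R i' = {p | p.swap ∈ R i}
  interNumber : ∀ i j l, ∃ c : ℕ, ∀ x y, (x, y) ∈ R l → interCount R i j x y = c

/-- All relations are symmetric. -/
def IsSymmetricFamily (R : I → Set (X × X)) : Prop :=
  ∀ i, {p | p.swap ∈ R i} = R i

/-- `p_{i,j}^l = p_{j,i}^l` for all `i, j, l`. -/
def IsCommutativeFamily (R : I → Set (X × X)) : Prop :=
  ∀ i j l x y, (x, y) ∈ R l → interCount R i j x y = interCount R j i x y

end Scheme

/-! ### Digraphs -/

section Digraphs

variable {V : Type*}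

/-- There is a path of length `r` from `x` to `y`. -/
def HasPath (Γ : Digraph V) (r : ℕ) (x y : V) : Prop :=
  ∃ w : ℕ → V, w 0 = x ∧ w r = y ∧ ∀ t < r, Γ.Adj (w t) (w (t + 1))

def StronglyConnected (Γ : Digraph V) : Prop :=
  ∀ x y, ∃ r, HasPath Γ r x y

/-- The length of a shortest path from `x` to `y` (used for strongly connected digraphs only). -/
noncomputable def dist (Γ : Digraph V) (x y : V) : ℕ :=
  sInf {r | HasPath Γ r x y}

/-- The two-way distance. -/
noncomputable def twoDist (Γ : Digraph V) (x y : V) : ℕ × ℕ :=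
  (dist Γ x y, dist Γ y x)

/-- The two-way distance set. -/
def twoDistSet (Γ : Digraph V) : Set (ℕ × ℕ) :=
  {i | ∃ x y, twoDist Γ x y = i}

/-- The relations of the attached configuration, indexed by the two-way distance set. -/
def attached (Γ : Digraph V) (i : twoDistSet Γ) : Set (V × V) :=
  {p | twoDist Γ p.1 p.2 = i}

/-- A digraph (without loops) is weakly distance-regular if it is strongly connected and its
attached configuration is a non-symmetric association scheme. -/
structure IsWeaklyDistanceRegular (Γ : Digraph V) : Prop where
  loopless : ∀ x, ¬ Γ.Adj x x
  stronglyConnected : StronglyConnected Γ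
  scheme : IsAssociationScheme (attached Γ)
  nonSymmetric : ¬ IsSymmetricFamily (attached Γ)

/-- Commutative weakly distance-regular digraphs. -/
structure IsCommWeaklyDistanceRegular (Γ : Digraph V) : Prop
    extends IsWeaklyDistanceRegular Γ where
  commutative : IsCommutativeFamily (attached Γ)

/-- The set `T` of all `q + 1` such that some arc has type `(1, q)`. -/
def arcTypes (Γ : Digraph V) : Set ℕ :=
  {t | ∃ q, (1, q) ∈ twoDistSet Γ ∧ t = q + 1}

end Digraphs

/-! ### Johnson graphs and folded Johnson graphs -/

/-- The Johnson graph `J(n, e)`: the `e`-subsets of an `n`-set, adjacent when they meet in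
`e - 1` elements. -/
def johnson (n e : ℕ) : SimpleGraph {x : Finset (Fin n) // x.card = e} where
  Adj x y := (x.1 ∩ y.1).card + 1 = e
  symm := ⟨fun x y h => by rw [Finset.inter_comm]; exact h⟩
  loopless := ⟨fun x h => by rw [Finset.inter_self, x.2] at h; omega⟩

/-- The folded Johnson graph `J̄(2e, e)`: the partitions `{x, xᶜ}` of a `2e`-set into two `e`-sets.
Two partitions with blocks `x` and `y` are adjacent when `|x ∩ y| ∈ {1, e - 1}`, i.e. when
their common refinement has blocks of sizes `1, e - 1, 1, e - 1`. -/
def foldedJohnson (e : ℕ) :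
    SimpleGraph {P : Finset (Finset (Fin (2 * e))) // ∃ x, x.card = e ∧ P = {x, xᶜ}} where
  Adj P Q := P ≠ Q ∧ ∃ x ∈ P.1, ∃ y ∈ Q.1, (x ∩ y).card = 1 ∨ (x ∩ y).card + 1 = e
  symm := ⟨fun P Q h => by
    obtain ⟨hne, x, hx, y, hy, h⟩ := h
    exact ⟨hne.symm, y, hy, x, hx, by rwa [Finset.inter_comm]⟩⟩
  loopless := ⟨fun P h => h.1 rfl⟩

end WDRD

/-!
Let `N` be the adjacency matrix of `Σ` and `S` the skew matrix with `S x y = 1` if `(x, y)` is an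
arc of `Γ`. If every arc has type `(1, 2)`, the arcs form one relation of the scheme, so `S`
commutes with `N`, has row sums `0`, and `S * N` agrees with `(p - q) • S` on edges, where each
arc lies in `3 p` transitive and `q > 0` cyclic triangles.

In a Johnson graph let `f x a b` be the entry of `S` at `x` and `x - a + b`. Comparing the common
neighbours of the ends of an edge gives `∑ b, f x a b = 0`. The `e`-sets containing a fixed set of
`e - 2` elements induce a triangular graph, where the skewness of `S * N` on disjoint pairs,
together with divisibility and parity, forces `f x a b + f x a' b = 0` for `a ≠ a'`. If `e ≥ 3`,
three elements of `x` give a contradiction. Only pairs of sets at distance at most `3` are involved,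
so the argument also applies to the folded graph `J̄(2e, e)`, the quotient by `x ↦ xᶜ`, if `e ≥ 5`.

In `J̄(8, 4)` disjoint pairs acquire extra common neighbours, but this graph is strongly regular
with parameters `(35, 16, 6, 8)`. Then `S * (N + 1) ^ 2 = 9 • S`, so `S ^ 2 * (N + 1)` is
nilpotent modulo `3`, and its trace contradicts `3 p + q = 6` with `q > 0`.
-/

namespace WDRD

open Finset Matrix

/-! ### Triangle-regular signings -/

section Signing

variable {V W : Type*} [Fintype V] [Fintype W]

/-- The skew `±1` matrix `S` of an orientation of the graph `G`, i.e. `S x y = 1` if and only if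
`x → y`. For each of the three transitive orientations of a triangle through an arc, exactly `p`
triangles through that arc are oriented this way, and `q > 0` of them are directed cycles. The
matrix equations over `ℤ` are the form in which this is used. -/
structure IsTriangleRegularSigning (G : SimpleGraph V) [DecidableRel G.Adj] (S : Matrix V V ℤ)
    (p q : ℕ) : Prop where
  transpose_eq : Sᵀ = -S
  hadamard_self : S ⊙ S = G.adjMatrix ℤ
  sum_row : ∀ x, ∑ y, S x y = 0
  commute : Commute S (G.adjMatrix ℤ)
  mul_adjMatrix_of_arc : ∀ x y, S x y = 1 → (S * G.adjMatrix ℤ) x y = p - q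
  adjMatrix_sq_of_arc : ∀ x y, S x y = 1 → (G.adjMatrix ℤ * G.adjMatrix ℤ) x y = 3 * p + q
  pos : 0 < q

namespace IsTriangleRegularSigning

variable {G : SimpleGraph V} [DecidableRel G.Adj] {S : Matrix V V ℤ} {p q : ℕ}

theorem apply_swap (hS : IsTriangleRegularSigning G S p q) (x y : V) : S y x = -S x y :=
  congrFun₂ hS.transpose_eq x y

theorem mul_self_apply (hS : IsTriangleRegularSigning G S p q) (x y : V) :
    S x y * S x y = if G.Adj x y then 1 else 0 := by
  rw [← hadamard_apply, hS.hadamard_self, SimpleGraph.adjMatrix_apply]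

theorem apply_eq_zero (hS : IsTriangleRegularSigning G S p q) {x y : V} (h : ¬ G.Adj x y) :
    S x y = 0 := by
  simpa only [if_neg h, mul_self_eq_zero] using hS.mul_self_apply x y

theorem apply_eq_one_or (hS : IsTriangleRegularSigning G S p q) {x y : V} (h : G.Adj x y) :
    S x y = 1 ∨ S x y = -1 := by
  simpa only [if_pos h, mul_self_eq_one_iff] using hS.mul_self_apply x y

theorem mul_adjMatrix_apply_swap (hS : IsTriangleRegularSigning G S p q) (x y : V) :
    (S * G.adjMatrix ℤ) y x = -(S * G.adjMatrix ℤ) x y := by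
  rw [← transpose_apply (S * G.adjMatrix ℤ), transpose_mul, SimpleGraph.transpose_adjMatrix,
    hS.transpose_eq, mul_neg, neg_apply, hS.commute.eq]

theorem mul_adjMatrix_apply (hS : IsTriangleRegularSigning G S p q) {x y : V} (h : G.Adj x y) :
    (S * G.adjMatrix ℤ) x y = (p - q) * S x y := by
  obtain hxy | hxy := hS.apply_eq_one_or h
  · rw [hS.mul_adjMatrix_of_arc x y hxy, hxy, mul_one]
  · have hyx : S y x = 1 := by rw [hS.apply_swap x, hxy, neg_neg]
    rw [hS.mul_adjMatrix_apply_swap y, hS.mul_adjMatrix_of_arc y x hyx, hxy, mul_neg_one]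

theorem adjMatrix_mul_self_apply (hS : IsTriangleRegularSigning G S p q) {x y : V}
    (h : G.Adj x y) : (G.adjMatrix ℤ * G.adjMatrix ℤ) x y = 3 * p + q := by
  obtain hxy | hxy := hS.apply_eq_one_or h
  · exact hS.adjMatrix_sq_of_arc x y hxy
  · have hyx : S y x = 1 := by rw [hS.apply_swap x, hxy, neg_neg]
    rw [← hS.adjMatrix_sq_of_arc y x hyx, ← transpose_apply (_ * _), transpose_mul,
      SimpleGraph.transpose_adjMatrix]

theorem mul_adjMatrix_apply_eq_sum [DecidableEq V] (hS : IsTriangleRegularSigning G S p q)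
    (x y : V) : (S * G.adjMatrix ℤ) x y = ∑ z ∈ G.neighborFinset x ∩ G.neighborFinset y, S x z := by
  rw [SimpleGraph.mul_adjMatrix_apply]
  refine (sum_subset inter_subset_right fun z hzy hz => hS.apply_eq_zero fun hxz => hz ?_).symm
  exact mem_inter.2 ⟨(G.mem_neighborFinset x z).2 hxz, hzy⟩

theorem card_inter_neighborFinset [DecidableEq V] (hS : IsTriangleRegularSigning G S p q) {x y : V}
    (h : G.Adj x y) : #(G.neighborFinset x ∩ G.neighborFinset y) = 3 * p + q := by
  have hsq := hS.adjMatrix_mul_self_apply h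
  rw [SimpleGraph.mul_adjMatrix_apply] at hsq
  simp only [SimpleGraph.adjMatrix_apply, sum_boole] at hsq
  have hfilter : G.neighborFinset x ∩ G.neighborFinset y =
      {z ∈ G.neighborFinset y | G.Adj x z} := by
    ext z
    simp only [mem_inter, mem_filter, SimpleGraph.mem_neighborFinset, and_comm]
  rw [hfilter]
  exact_mod_cast hsq

theorem reindex {H : SimpleGraph W} [DecidableRel H.Adj]
    (hS : IsTriangleRegularSigning G S p q) (φ : G ≃g H) :
    IsTriangleRegularSigning H (S.submatrix φ.symm φ.symm) p q := by
  have hN : H.adjMatrix ℤ = (G.adjMatrix ℤ).submatrix φ.symm φ.symm := by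
    ext x y
    simp only [submatrix_apply, SimpleGraph.adjMatrix_apply, φ.symm.map_adj_iff]
  have hmul (A B : Matrix V V ℤ) : A.submatrix φ.symm φ.symm * B.submatrix φ.symm φ.symm =
      (A * B).submatrix φ.symm φ.symm := submatrix_mul_equiv A B _ φ.symm.toEquiv _
  refine ⟨?_, ?_, fun x => ?_, ?_, fun x y h => ?_, fun x y h => ?_, hS.pos⟩
  · rw [transpose_submatrix, hS.transpose_eq, submatrix_neg]
    rfl
  · rw [hN, ← hS.hadamard_self]
    rfl
  · rw [← hS.sum_row (φ.symm x)]
    exact φ.symm.toEquiv.sum_comp (S (φ.symm x))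
  · rw [Commute, SemiconjBy, hN, hmul, hmul, hS.commute.eq]
  · rw [hN, hmul]
    exact hS.mul_adjMatrix_of_arc _ _ h
  · rw [hN, hmul]
    exact hS.adjMatrix_sq_of_arc _ _ h

end IsTriangleRegularSigning

end Signing

section SchemeSigning

variable {X I : Type*}

open scoped Classical in
/-- The `0`-`1` matrix of a relation, over `ℤ`. -/
noncomputable def relMatrix (r : Set (X × X)) : Matrix X X ℤ :=
  of fun x y => if (x, y) ∈ r then 1 else 0

theorem relMatrix_of_mem {r : Set (X × X)} {x y : X} (h : (x, y) ∈ r) : relMatrix r x y = 1 :=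
  if_pos h

theorem relMatrix_of_notMem {r : Set (X × X)} {x y : X} (h : (x, y) ∉ r) :
    relMatrix r x y = 0 :=
  if_neg h

theorem relMatrix_mul_self (r : Set (X × X)) (x y : X) :
    relMatrix r x y * relMatrix r x y = relMatrix r x y := by
  by_cases h : (x, y) ∈ r
  · rw [relMatrix_of_mem h, one_mul]
  · rw [relMatrix_of_notMem h, zero_mul]

theorem relMatrix_nonneg (r : Set (X × X)) (x y : X) : 0 ≤ relMatrix r x y := by
  rw [← relMatrix_mul_self]
  exact mul_self_nonneg _

theorem transpose_relMatrix (r : Set (X × X)) :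
    (relMatrix r)ᵀ = relMatrix {p | p.swap ∈ r} :=
  rfl

theorem relMatrix_add_transpose {G : SimpleGraph X} [DecidableRel G.Adj] {r : Set (X × X)}
    (hasymm : ∀ x y, (x, y) ∈ r → (y, x) ∉ r)
    (hG : ∀ x y, G.Adj x y ↔ (x, y) ∈ r ∨ (y, x) ∈ r) :
    relMatrix r + (relMatrix r)ᵀ = G.adjMatrix ℤ := by
  ext x y
  have := hasymm x y
  by_cases hxy : (x, y) ∈ r <;> by_cases hyx : (y, x) ∈ r <;>
    simp_all [relMatrix]

theorem relMatrix_sub_transpose_hadamard_self {r : Set (X × X)}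
    (hasymm : ∀ x y, (x, y) ∈ r → (y, x) ∉ r) :
    (relMatrix r - (relMatrix r)ᵀ) ⊙ (relMatrix r - (relMatrix r)ᵀ) =
      relMatrix r + (relMatrix r)ᵀ := by
  ext x y
  have := hasymm x y
  by_cases hxy : (x, y) ∈ r <;> by_cases hyx : (y, x) ∈ r <;>
    simp_all [relMatrix]

variable {R : I → Set (X × X)}

theorem IsAssociationScheme.exists_transpose_relMatrix (hR : IsAssociationScheme R) (i : I) :
    ∃ i', (relMatrix (R i))ᵀ = relMatrix (R i') := by
  obtain ⟨i', hi'⟩ := hR.transpose i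
  exact ⟨i', by rw [transpose_relMatrix, hi']⟩

variable [Fintype X]

theorem relMatrix_mul_relMatrix_apply (i j : I) (x y : X) :
    (relMatrix (R i) * relMatrix (R j)) x y = interCount R i j x y := by
  classical
  simp only [relMatrix, mul_apply, of_apply, ite_zero_mul_ite_zero, mul_one, sum_boole,
    interCount, Set.ncard_eq_toFinset_card', Set.toFinset_ofPred]

theorem IsAssociationScheme.exists_relMatrix_mul_apply (hR : IsAssociationScheme R) (i j l : I) :
    ∃ c : ℕ, ∀ x y, (x, y) ∈ R l → (relMatrix (R i) * relMatrix (R j)) x y = c := by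
  obtain ⟨c, hc⟩ := hR.interNumber i j l
  exact ⟨c, fun x y h => by rw [relMatrix_mul_relMatrix_apply, hc x y h]⟩

theorem IsAssociationScheme.commute_relMatrix (hR : IsAssociationScheme R)
    (hcomm : IsCommutativeFamily R) (i j : I) : Commute (relMatrix (R i)) (relMatrix (R j)) := by
  ext x y
  obtain ⟨l, hl, -⟩ := hR.partition (x, y)
  rw [relMatrix_mul_relMatrix_apply, relMatrix_mul_relMatrix_apply, hcomm i j l x y hl]

theorem sum_row_relMatrix_eq_sum_col {r : Set (X × X)}
    (h : Commute (relMatrix r) (relMatrix r)ᵀ) (x : X) :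
    ∑ y, relMatrix r x y = ∑ y, relMatrix r y x := by
  simpa only [mul_apply, transpose_apply, relMatrix_mul_self] using congrFun₂ h.eq x x

theorem trace_mul_transpose_mul_self {α : Type*} [CommSemiring α] (A : Matrix X X α) :
    trace (A * (A * A)ᵀ) = trace (A * (A * Aᵀ)ᵀ) := by
  rw [← trace_transpose (A * (A * A)ᵀ), transpose_mul, transpose_transpose, transpose_mul,
    transpose_transpose, mul_assoc]

/-- Summed over all arcs, both counts are the number of transitive triangles. -/
theorem eq_of_relMatrix_mul_apply {r : Set (X × X)} {a b : ℤ} (hr : r.Nonempty)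
    (ha : ∀ x y, (x, y) ∈ r → (relMatrix r * relMatrix r) x y = a)
    (hb : ∀ x y, (x, y) ∈ r → (relMatrix r * (relMatrix r)ᵀ) x y = b) : a = b := by
  classical
  have trace_eq {B : Matrix X X ℤ} {c : ℤ} (hB : ∀ x y, (x, y) ∈ r → B x y = c) :
      trace (relMatrix r * Bᵀ) = #{p | p ∈ r} * c := by
    rw [← sum_hadamard_eq, ← Fintype.sum_prod_type' fun x y => (relMatrix r ⊙ B) x y,
      ← sum_boole, sum_mul]
    refine sum_congr rfl fun p _ => ?_
    by_cases h : p ∈ r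
    · rw [hadamard_apply, hB _ _ h, relMatrix_of_mem h, if_pos h]
    · rw [hadamard_apply, relMatrix_of_notMem h, if_neg h, zero_mul, zero_mul]
  have hcard : (#{p | p ∈ r} : ℤ) ≠ 0 := by
    obtain ⟨p, hp⟩ := hr
    exact_mod_cast card_ne_zero_of_mem (mem_filter_univ p |>.2 hp)
  exact mul_left_cancel₀ hcard
    (by rw [← trace_eq ha, ← trace_eq hb, trace_mul_transpose_mul_self])

theorem relMatrix_mul_pos {r s : Set (X × X)} {x y z : X} (hxz : (x, z) ∈ r) (hzy : (z, y) ∈ s) :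
    0 < (relMatrix r * relMatrix s) x y := by
  refine sum_pos' (fun w _ => mul_nonneg (relMatrix_nonneg r x w) (relMatrix_nonneg s w y))
    ⟨z, mem_univ z, mul_pos ?_ ?_⟩
  · exact one_pos.trans_eq (relMatrix_of_mem hxz).symm
  · exact one_pos.trans_eq (relMatrix_of_mem hzy).symm

theorem isTriangleRegularSigning_of_normal {r : Set (X × X)} {p q : ℕ}
    {G : SimpleGraph X} [DecidableRel G.Adj] (hG : ∀ x y, G.Adj x y ↔ (x, y) ∈ r ∨ (y, x) ∈ r)
    (hasymm : ∀ x y, (x, y) ∈ r → (y, x) ∉ r) (hnormal : Commute (relMatrix r) (relMatrix r)ᵀ)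
    (hp : ∀ x y, (x, y) ∈ r → (relMatrix r * relMatrix r) x y = p)
    (hp' : ∀ x y, (x, y) ∈ r → (relMatrix r * (relMatrix r)ᵀ) x y = p)
    (hq : ∀ x y, (x, y) ∈ r → ((relMatrix r)ᵀ * (relMatrix r)ᵀ) x y = q) (hqpos : 0 < q) :
    IsTriangleRegularSigning G (relMatrix r - (relMatrix r)ᵀ) p q := by
  have hadd := relMatrix_add_transpose hasymm hG
  have hsub_mul : (relMatrix r - (relMatrix r)ᵀ) * G.adjMatrix ℤ =
      relMatrix r * relMatrix r - (relMatrix r)ᵀ * (relMatrix r)ᵀ := by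
    rw [← hadd, hnormal.mul_self_sub_mul_self_eq']
  have hadd_mul : G.adjMatrix ℤ * G.adjMatrix ℤ = relMatrix r * relMatrix r +
      2 • (relMatrix r * (relMatrix r)ᵀ) + (relMatrix r)ᵀ * (relMatrix r)ᵀ := by
    rw [← hadd, add_mul, mul_add, mul_add, ← hnormal.eq]
    abel
  have mem_of_arc {x y : X} (h : (relMatrix r - (relMatrix r)ᵀ) x y = 1) : (x, y) ∈ r := by
    by_contra hxy
    rw [Matrix.sub_apply, relMatrix_of_notMem hxy, transpose_apply] at h
    linarith [relMatrix_nonneg r y x]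
  refine ⟨?_, ?_, ?_, ?_, fun x y h => ?_, fun x y h => ?_, hqpos⟩
  · rw [transpose_sub, transpose_transpose, neg_sub]
  · rw [relMatrix_sub_transpose_hadamard_self hasymm, hadd]
  · intro x
    simp only [Matrix.sub_apply, transpose_apply, sum_sub_distrib,
      sum_row_relMatrix_eq_sum_col hnormal, sub_self]
  · exact hadd ▸ ((Commute.refl _).add_right hnormal).sub_left
      (hnormal.symm.add_right (Commute.refl _))
  · rw [hsub_mul, Matrix.sub_apply, hp x y (mem_of_arc h), hq x y (mem_of_arc h)]
  · rw [hadd_mul, Matrix.add_apply, Matrix.add_apply, Matrix.smul_apply, hp x y (mem_of_arc h),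
      hp' x y (mem_of_arc h), hq x y (mem_of_arc h)]
    ring

theorem IsAssociationScheme.exists_isTriangleRegularSigning (hR : IsAssociationScheme R)
    (hcomm : IsCommutativeFamily R) {i : I} (hasymm : ∀ x y, (x, y) ∈ R i → (y, x) ∉ R i)
    (hcyc : ∀ x y, (x, y) ∈ R i → ∃ z, (y, z) ∈ R i ∧ (z, x) ∈ R i)
    {G : SimpleGraph X} [DecidableRel G.Adj]
    (hG : ∀ x y, G.Adj x y ↔ (x, y) ∈ R i ∨ (y, x) ∈ R i) :
    ∃ p q, IsTriangleRegularSigning G (relMatrix (R i) - (relMatrix (R i))ᵀ) p q := by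
  obtain ⟨i', hi'⟩ := hR.exists_transpose_relMatrix i
  have hnormal : Commute (relMatrix (R i)) (relMatrix (R i))ᵀ :=
    hi' ▸ hR.commute_relMatrix hcomm i i'
  obtain ⟨p, hp⟩ := hR.exists_relMatrix_mul_apply i i i
  obtain ⟨s, hs⟩ := hR.exists_relMatrix_mul_apply i i' i
  obtain ⟨q, hq⟩ := hR.exists_relMatrix_mul_apply i' i' i
  rw [← hi'] at hs hq
  have hps : (p : ℤ) = s := eq_of_relMatrix_mul_apply (hR.nonempty i) hp hs
  rw [← hps] at hs
  have hqpos : 0 < q := by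
    obtain ⟨⟨x, y⟩, hxy⟩ := hR.nonempty i
    obtain ⟨z, hyz, hzx⟩ := hcyc x y hxy
    have hpos := relMatrix_mul_pos hyz hzx
    rw [← transpose_apply (_ * _), transpose_mul, hq x y hxy] at hpos
    exact_mod_cast hpos
  exact ⟨p, q, isTriangleRegularSigning_of_normal hG hasymm hnormal hp hs hq hqpos⟩

end SchemeSigning

section DigraphSigning

variable {V : Type*} {Γ : Digraph V} {x y : V}

theorem hasPath_zero_iff : HasPath Γ 0 x y ↔ x = y := by
  constructor
  · rintro ⟨w, rfl, rfl, -⟩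
    rfl
  · rintro rfl
    exact ⟨fun _ => x, rfl, rfl, fun t ht => absurd ht (Nat.not_lt_zero t)⟩

theorem hasPath_one_iff : HasPath Γ 1 x y ↔ Γ.Adj x y := by
  constructor
  · rintro ⟨w, rfl, rfl, h⟩
    exact h 0 one_pos
  · intro h
    refine ⟨fun t => if t = 0 then x else y, rfl, rfl, fun t ht => ?_⟩
    obtain rfl : t = 0 := Nat.lt_one_iff.1 ht
    exact h

theorem HasPath.exists_adj_adj (h : HasPath Γ 2 x y) : ∃ z, Γ.Adj x z ∧ Γ.Adj z y := by
  obtain ⟨w, rfl, rfl, h⟩ := h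
  exact ⟨w 1, h 0 two_pos, h 1 one_lt_two⟩

theorem StronglyConnected.hasPath_dist (hΓ : StronglyConnected Γ) (x y : V) :
    HasPath Γ (dist Γ x y) x y :=
  Nat.sInf_mem (s := {r | HasPath Γ r x y}) (hΓ x y)

theorem StronglyConnected.dist_eq_one_iff (hΓ : StronglyConnected Γ) (hne : x ≠ y) :
    dist Γ x y = 1 ↔ Γ.Adj x y := by
  have hpath := hΓ.hasPath_dist x y
  refine ⟨fun h => hasPath_one_iff.1 (h ▸ hpath), fun h => ?_⟩
  refine le_antisymm (Nat.sInf_le (hasPath_one_iff.2 h)) (Nat.one_le_iff_ne_zero.2 fun h0 => ?_)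
  rw [h0] at hpath
  exact hne (hasPath_zero_iff.1 hpath)

theorem IsWeaklyDistanceRegular.adj_iff_twoDist_eq (hΓ : IsWeaklyDistanceRegular Γ)
    (hT : arcTypes Γ = {3}) : Γ.Adj x y ↔ twoDist Γ x y = (1, 2) := by
  have hsc := hΓ.stronglyConnected
  constructor
  · intro h
    have hne : x ≠ y := by
      rintro rfl
      exact hΓ.loopless x h
    have hxy := (hsc.dist_eq_one_iff hne).2 h
    have hyx : dist Γ y x + 1 ∈ arcTypes Γ := ⟨_, ⟨x, y, by rw [twoDist, hxy]⟩, rfl⟩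
    rw [hT, Set.mem_singleton_iff] at hyx
    rw [twoDist, hxy, Nat.succ_injective hyx]
  · intro h
    have hpath := hsc.hasPath_dist x y
    rwa [show dist Γ x y = 1 from congrArg Prod.fst h, hasPath_one_iff] at hpath

theorem IsCommWeaklyDistanceRegular.exists_isTriangleRegularSigning [Fintype V]
    [DecidableRel Γ.toSimpleGraphInclusive.Adj] (hΓ : IsCommWeaklyDistanceRegular Γ)
    (hT : arcTypes Γ = {3}) :
    ∃ S p q, IsTriangleRegularSigning Γ.toSimpleGraphInclusive S p q := by
  have hadj {x y : V} : Γ.Adj x y ↔ twoDist Γ x y = (1, 2) := hΓ.adj_iff_twoDist_eq hT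
  have hmem : (1, 2) ∈ twoDistSet Γ := by
    obtain ⟨q, hq, h3⟩ : 3 ∈ arcTypes Γ := hT ▸ rfl
    rwa [← Nat.succ_injective h3] at hq
  have hasymm (x y : V) (hxy : twoDist Γ x y = (1, 2)) : twoDist Γ y x ≠ (1, 2) := by
    have hyx : twoDist Γ y x = (2, 1) := congrArg Prod.swap hxy
    rw [hyx]
    decide
  have hcyc (x y : V) (hxy : twoDist Γ x y = (1, 2)) :
      ∃ z, twoDist Γ y z = (1, 2) ∧ twoDist Γ z x = (1, 2) := by
    have hpath := hΓ.stronglyConnected.hasPath_dist y x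
    rw [show dist Γ y x = 2 from congrArg Prod.snd hxy] at hpath
    simpa only [hadj] using hpath.exists_adj_adj
  refine ⟨_, hΓ.scheme.exists_isTriangleRegularSigning hΓ.commutative (i := ⟨(1, 2), hmem⟩)
    hasymm hcyc fun x y => ?_⟩
  rw [Digraph.toSimpleGraphInclusive, SimpleGraph.fromRel_adj, and_iff_right_of_imp]
  · exact or_congr hadj hadj
  · rintro h rfl
    exact hΓ.loopless x (or_self_iff.1 h)

end DigraphSigning

/-! ### Signings of triangular graphs -/

section TriangularSigning

variable {ι α : Type*} {s : Finset α}

theorem even_sum_add_card {s : Finset ι} {f : ι → ℤ} (hf : ∀ i ∈ s, f i = 1 ∨ f i = -1) :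
    Even (∑ i ∈ s, f i + #s) := by
  rw [card_eq_sum_ones, Nat.cast_sum, ← sum_add_distrib]
  refine even_sum _ fun i hi => ?_
  obtain h | h := hf i hi <;> rw [h] <;> decide

theorem sum_eq_zero_of_natCast_dvd {s : Finset ι} {f : ι → ℤ} {k : ℕ} (hk : 2 ≤ k)
    (hs : #s = k + 1) (hf : ∀ i ∈ s, f i = 1 ∨ f i = -1) (hdvd : (k : ℤ) ∣ ∑ i ∈ s, f i) :
    ∑ i ∈ s, f i = 0 := by
  obtain ⟨m, hm⟩ := hdvd
  have hle : |∑ i ∈ s, f i| ≤ k + 1 := by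
    refine (abs_sum_le_sum_abs f s).trans ?_
    rw [sum_congr rfl fun i hi => abs_eq zero_le_one |>.2 (hf i hi), sum_const, hs]
    simp
  have heven := even_sum_add_card hf
  rw [hs, hm] at heven
  rw [hm, abs_le] at hle
  have hm_lt : m < 2 := by nlinarith
  have hm_gt : -2 < m := by nlinarith
  interval_cases m
  · grind
  · rw [hm, mul_zero]
  · grind

variable [DecidableEq α]

/-- A skew `±1` signing of the triangular graph on the pairs of elements of `s`, where `t b a c` is
the sign of `{a, b} → {c, b}`: it vanishes in total on the arcs from `{a, b}` that keep `b`, and on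
the eight arcs from either of two disjoint pairs to their common neighbours. -/
structure IsBalancedTriangularSigning (s : Finset α) (t : α → α → α → ℤ) : Prop where
  skew : ∀ b a c, t b c a = -t b a c
  sign : ∀ {a b c}, a ∈ s → b ∈ s → c ∈ s → a ≠ b → b ≠ c → a ≠ c → t b a c = 1 ∨ t b a c = -1
  sum_keep : ∀ {a b}, a ∈ s → b ∈ s → a ≠ b → ∑ c ∈ s \ {a, b}, t b a c = 0
  sum_disjoint : ∀ {a b c d}, a ∈ s → b ∈ s → c ∈ s → d ∈ s →
    a ≠ b → a ≠ c → a ≠ d → b ≠ c → b ≠ d → c ≠ d →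
    t a b c + t a b d + t b a c + t b a d + (t c d a + t c d b + t d c a + t d c b) = 0

namespace IsBalancedTriangularSigning

variable {t : α → α → α → ℤ}

/-- Sum `sum_disjoint` over all choices of `d`. -/
theorem card_sub_three_mul (ht : IsBalancedTriangularSigning s t) {a b c : α} (ha : a ∈ s)
    (hb : b ∈ s) (hc : c ∈ s) (hab : a ≠ b) (hac : a ≠ c) (hbc : b ≠ c) :
    (#s - 3) * (t a b c + t b a c) = ∑ d ∈ s \ {a, c}, t d a c + ∑ d ∈ s \ {b, c}, t d b c := by
  have sum_rest {x y z : α} (h : ({x, y, z} : Finset α) = {a, b, c}) (hz : z ∈ s \ {x, y})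
      (f : α → ℤ) : ∑ d ∈ s \ {a, b, c}, f d = ∑ d ∈ s \ {x, y}, f d - f z := by
    rw [← h, ← sum_erase_eq_sub hz]
    congr 1
    grind
  have hcard : (#(s \ {a, b, c}) : ℤ) = #s - 3 := by
    have := card_sdiff_add_card_eq_card (show {a, b, c} ⊆ s by grind)
    rw [card_eq_three.2 ⟨a, b, c, hab, hac, hbc, rfl⟩] at this
    lia
  have hsum : ∑ d ∈ s \ {a, b, c},
      (t a b c + t a b d + t b a c + t b a d + (t c d a + t c d b + t d c a + t d c b)) = 0 :=
    sum_eq_zero fun d hd => ht.sum_disjoint ha hb hc (mem_sdiff.1 hd).1 hab hac (by grind) hbc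
      (by grind) (by grind)
  simp only [ht.skew c a, ht.skew c b, ht.skew _ a c, ht.skew _ b c, sum_add_distrib,
    sum_neg_distrib, sum_const, nsmul_eq_mul, hcard] at hsum
  rw [sum_rest (x := b) (y := a) (z := c) (by grind) (by grind) (t a b),
    sum_rest (x := a) (y := b) (z := c) (by grind) (by grind) (t b a),
    sum_rest (x := a) (y := c) (z := b) (by grind) (by grind) (t c a),
    sum_rest (x := b) (y := c) (z := a) (by grind) (by grind) (t c b),
    sum_rest (x := a) (y := c) (z := b) (by grind) (by grind) fun d => t d a c,
    sum_rest (x := b) (y := c) (z := a) (by grind) (by grind) fun d => t d b c,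
    ht.sum_keep hb ha hab.symm, ht.sum_keep ha hb hab, ht.sum_keep ha hc hac,
    ht.sum_keep hb hc hbc] at hsum
  linarith [ht.skew c a b]

theorem natCast_dvd_sum (ht : IsBalancedTriangularSigning s t) {k : ℕ} (hk : 1 ≤ k)
    (hs : #s = k + 3) {a c : α} (ha : a ∈ s) (hc : c ∈ s) (hac : a ≠ c) :
    (k : ℤ) ∣ ∑ d ∈ s \ {a, c}, t d a c := by
  obtain ⟨b, hb, b', hb', hbb'⟩ : ∃ b ∈ s \ {a, c}, ∃ b' ∈ s \ {a, c}, b ≠ b' := by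
    refine one_lt_card.1 ?_
    rw [card_sdiff_of_subset (by grind), card_pair hac]
    lia
  simp only [mem_sdiff, mem_insert, mem_singleton, not_or] at hb hb'
  have even_add {x y : α} (hx : x ∈ s) (hy : y ∈ s) (hxy : x ≠ y) (hxc : x ≠ c) (hyc : y ≠ c) :
      Even (t x y c + t y x c) := by
    obtain h | h := ht.sign hy hx hc hxy.symm hxc hyc <;>
      obtain h' | h' := ht.sign hx hy hc hxy hyc hxc <;> rw [h, h'] <;> decide
  have hb_mul := ht.card_sub_three_mul ha hb.1 hc (Ne.symm hb.2.1) hac hb.2.2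
  have hb'_mul := ht.card_sub_three_mul ha hb'.1 hc (Ne.symm hb'.2.1) hac hb'.2.2
  have hbb'_mul := ht.card_sub_three_mul hb.1 hb'.1 hc hbb' hb.2.2 hb'.2.2
  obtain ⟨u, hu⟩ := even_add ha hb.1 (Ne.symm hb.2.1) hac hb.2.2
  obtain ⟨v, hv⟩ := even_add ha hb'.1 (Ne.symm hb'.2.1) hac hb'.2.2
  obtain ⟨w, hw⟩ := even_add hb.1 hb'.1 hbb' hb.2.2 hb'.2.2
  rw [hu] at hb_mul
  rw [hv] at hb'_mul
  rw [hw] at hbb'_mul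
  have hk' : (#s : ℤ) - 3 = k := by lia
  rw [hk'] at hb_mul hb'_mul hbb'_mul
  exact ⟨u + v - w, by linarith⟩

/-- A sum of `#s - 2` signs that is divisible by `#s - 3` vanishes, by size and parity. -/
theorem sum_eq_zero (ht : IsBalancedTriangularSigning s t) (hs : 5 ≤ #s) {a c : α}
    (ha : a ∈ s) (hc : c ∈ s) (hac : a ≠ c) : ∑ d ∈ s \ {a, c}, t d a c = 0 := by
  obtain ⟨k, hk⟩ : ∃ k, #s = k + 3 := Nat.exists_eq_add_of_le' (by lia)
  refine sum_eq_zero_of_natCast_dvd (k := k) (by lia) ?_ (fun d hd => ?_)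
    (ht.natCast_dvd_sum (by lia) hk ha hc hac)
  · rw [card_sdiff_of_subset (by grind), card_pair hac]
    lia
  · exact ht.sign ha (by grind) hc (by grind) (by grind) hac

theorem apply_add_apply_swap (ht : IsBalancedTriangularSigning s t) (hs : 5 ≤ #s) {a b c : α}
    (ha : a ∈ s) (hb : b ∈ s) (hc : c ∈ s) (hab : a ≠ b) (hac : a ≠ c) (hbc : b ≠ c) :
    t a b c + t b a c = 0 := by
  have h := ht.card_sub_three_mul ha hb hc hab hac hbc
  rw [ht.sum_eq_zero hs ha hc hac, ht.sum_eq_zero hs hb hc hbc, add_zero] at h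
  exact (mul_eq_zero.1 h).resolve_left (by lia)

end IsBalancedTriangularSigning

end TriangularSigning

/-! ### Johnson covers -/

section Exchange

variable {α : Type*} [DecidableEq α] {x y : Finset α} {a b c d : α}

/-- Exchange `a` for `b`; the neighbours of `x` in a Johnson graph are the sets `exchange x a b`
with `a ∈ x` and `b ∉ x`. -/
def exchange (x : Finset α) (a b : α) : Finset α :=
  insert b (x.erase a)

theorem mem_exchange_iff_ne (hb : b ∉ x) (hc : c ∈ x) : c ∈ exchange x a b ↔ c ≠ a := by
  grind [exchange]

theorem mem_exchange_iff_eq (hd : d ∉ x) : d ∈ exchange x a b ↔ d = b := by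
  grind [exchange]

theorem exchange_insert_self (ha : a ∉ x) : exchange (insert a x) a b = insert b x := by
  rw [exchange, erase_insert ha]

theorem card_exchange (ha : a ∈ x) (hb : b ∉ x) : #(exchange x a b) = #x := by
  rw [exchange, card_insert_of_notMem fun h => hb (mem_of_mem_erase h), card_erase_add_one ha]

theorem card_exchange_inter (ha : a ∈ x) (hb : b ∉ x) (y : Finset α) :
    #(exchange x a b ∩ y) + (if a ∈ y then 1 else 0) = #(x ∩ y) + if b ∈ y then 1 else 0 := by
  have herase : #(x.erase a ∩ y) + (if a ∈ y then 1 else 0) = #(x ∩ y) := by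
    rw [erase_inter]
    split_ifs with hay
    · exact card_erase_add_one (mem_inter.2 ⟨ha, hay⟩)
    · rw [erase_eq_of_notMem fun h => hay (mem_inter.1 h).2, add_zero]
  rw [← herase, exchange]
  by_cases hby : b ∈ y
  · rw [if_pos hby, insert_inter_of_mem hby, card_insert_of_notMem (by grind)]
    ring
  · rw [if_neg hby, insert_inter_of_notMem hby, add_zero]

theorem card_inter_exchange_add_one (ha : a ∈ x) (hb : b ∉ x) :
    #(x ∩ exchange x a b) + 1 = #x := by
  simpa [inter_comm, ha, hb] using card_exchange_inter ha hb x

theorem exists_exchange_eq (hxy : #y = #x) (h : #(x ∩ y) + 1 = #x) :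
    ∃ a ∈ x, ∃ b ∉ x, exchange x a b = y := by
  obtain ⟨a, ha⟩ : ∃ a, x \ y = {a} := card_eq_one.1 (by rw [card_sdiff, inter_comm]; lia)
  obtain ⟨b, hb⟩ : ∃ b, y \ x = {b} := card_eq_one.1 (by rw [card_sdiff]; lia)
  obtain ⟨hax, hay⟩ := mem_sdiff.1 (ha ▸ mem_singleton_self a)
  obtain ⟨-, hbx⟩ := mem_sdiff.1 (hb ▸ mem_singleton_self b)
  refine ⟨a, hax, b, hbx, (eq_of_subset_of_card_le (fun c hc => ?_) ?_).symm⟩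
  · by_cases hcx : c ∈ x
    · exact (mem_exchange_iff_ne hbx hcx).2 fun h => hay (h ▸ hc)
    · exact (mem_exchange_iff_eq hcx).2 (mem_singleton.1 (hb ▸ mem_sdiff.2 ⟨hc, hcx⟩))
  · rw [card_exchange hax hbx, hxy]

theorem exchange_inj (ha : a ∈ x) (hb : b ∉ x) (hd : d ∉ x)
    (h : exchange x a b = exchange x c d) : a = c ∧ b = d := by
  constructor
  · by_contra hac
    exact (mem_exchange_iff_ne hb ha).1 (h ▸ (mem_exchange_iff_ne hd ha).2 hac) rfl
  · exact (mem_exchange_iff_eq hb).1 (h ▸ (mem_exchange_iff_eq hb).2 rfl)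

end Exchange

section JohnsonCover

variable {V α : Type*} [DecidableEq α]

/-- A map from the `e`-subsets of `α` onto (a union of components of) the graph `G` that carries
the neighbourhood of a set `x` in the Johnson graph onto that of `π x`, and that is injective and
reflects adjacency on pairs at distance at most `r`. Values off the `e`-subsets are irrelevant. -/
structure IsJohnsonCover (G : SimpleGraph V) (e r : ℕ) (π : Finset α → V) : Prop where
  adj_iff : ∀ {x y}, #x = e → #y = e → e ≤ #(x ∩ y) + r →
    (G.Adj (π x) (π y) ↔ #(x ∩ y) + 1 = e)
  injOn : ∀ {x y}, #x = e → #y = e → e ≤ #(x ∩ y) + r → π x = π y → x = y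
  exists_exchange : ∀ {x z}, #x = e → G.Adj (π x) z → ∃ a ∈ x, ∃ b ∉ x, π (exchange x a b) = z

namespace IsJohnsonCover

variable {G : SimpleGraph V} {e r : ℕ} {π : Finset α → V} {x y : Finset α} {a b : α}

theorem adj_exchange (hπ : IsJohnsonCover G e r π) (hr : 1 ≤ r) (hx : #x = e) (ha : a ∈ x)
    (hb : b ∉ x) : G.Adj (π x) (π (exchange x a b)) := by
  have h := card_inter_exchange_add_one ha hb
  exact (hπ.adj_iff hx ((card_exchange ha hb).trans hx) (by lia)).2 (by lia)

theorem exchange_adj_iff (hπ : IsJohnsonCover G e r π) (hx : #x = e) (hy : #y = e)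
    (hxy : e + 1 ≤ #(x ∩ y) + r) (ha : a ∈ x) (hb : b ∉ x) :
    G.Adj (π (exchange x a b)) (π y) ↔
      #(x ∩ y) + (if b ∈ y then 1 else 0) + 1 = e + if a ∈ y then 1 else 0 := by
  have h := card_exchange_inter ha hb y
  rw [hπ.adj_iff ((card_exchange ha hb).trans hx) hy (by grind)]
  lia

variable [Fintype V] [DecidableRel G.Adj] {M : Type*} [AddCommMonoid M]

theorem sum_neighborFinset [Fintype α] (hπ : IsJohnsonCover G e r π) (hr : 2 ≤ r) (hx : #x = e)
    (F : V → M) :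
    ∑ z ∈ G.neighborFinset (π x), F z = ∑ a ∈ x, ∑ b ∈ xᶜ, F (π (exchange x a b)) := by
  classical
  have himage : G.neighborFinset (π x) = (x ×ˢ xᶜ).image fun w => π (exchange x w.1 w.2) := by
    ext z
    simp only [SimpleGraph.mem_neighborFinset, mem_image, mem_product, mem_compl, Prod.exists]
    constructor
    · intro h
      obtain ⟨a, ha, b, hb, hz⟩ := hπ.exists_exchange hx h
      exact ⟨a, b, ⟨ha, hb⟩, hz⟩
    · rintro ⟨a, b, ⟨ha, hb⟩, rfl⟩
      exact hπ.adj_exchange (by lia) hx ha hb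
  rw [himage, sum_image, sum_product]
  rintro ⟨a, b⟩ hab ⟨c, d⟩ hcd h
  simp only [coe_product, Set.mem_prod, mem_coe, mem_compl] at hab hcd
  have hcard := card_exchange_inter hab.1 hab.2 (exchange x c d)
  have hcard' := card_inter_exchange_add_one hcd.1 hcd.2
  have heq := hπ.injOn ((card_exchange hab.1 hab.2).trans hx) ((card_exchange hcd.1 hcd.2).trans hx)
    (by grind) h
  exact Prod.ext_iff.2 (exchange_inj hab.1 hab.2 hcd.2 heq)

theorem sum_inter_neighborFinset [Fintype α] [DecidableEq V] (hπ : IsJohnsonCover G e r π)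
    (hr : 2 ≤ r) (hx : #x = e) (F : V → M) (v : V) :
    ∑ z ∈ G.neighborFinset (π x) ∩ G.neighborFinset v, F z =
      ∑ a ∈ x, ∑ b ∈ xᶜ, if G.Adj (π (exchange x a b)) v then F (π (exchange x a b)) else 0 := by
  rw [← hπ.sum_neighborFinset hr hx fun z => if G.Adj z v then F z else 0, ← sum_filter]
  congr 1
  ext z
  simp only [mem_inter, mem_filter, SimpleGraph.mem_neighborFinset, G.adj_comm v]

theorem sum_inter_neighborFinset_exchange [Fintype α] [DecidableEq V]
    (hπ : IsJohnsonCover G e r π) (hr : 2 ≤ r) (hx : #x = e) (ha : a ∈ x) (hb : b ∉ x) (F : V → M) :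
    ∑ z ∈ G.neighborFinset (π x) ∩ G.neighborFinset (π (exchange x a b)), F z =
      ∑ d ∈ xᶜ.erase b, F (π (exchange x a d)) + ∑ c ∈ x.erase a, F (π (exchange x c b)) := by
  have hcard := card_inter_exchange_add_one ha hb
  have hadj {c d : α} (hc : c ∈ x) (hd : d ∈ xᶜ) :
      G.Adj (π (exchange x c d)) (π (exchange x a b)) ↔ (c = a ↔ d ≠ b) := by
    rw [mem_compl] at hd
    rw [hπ.exchange_adj_iff hx ((card_exchange ha hb).trans hx) (by lia) hc hd]
    simp only [mem_exchange_iff_ne hb hc, mem_exchange_iff_eq hd]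
    grind
  rw [hπ.sum_inter_neighborFinset hr hx, ← add_sum_erase x _ ha]
  congr 1
  · rw [← sum_erase_add xᶜ _ (mem_compl.2 hb), if_neg G.irrefl, add_zero]
    refine sum_congr rfl fun d hd => if_pos ?_
    rw [hadj ha (mem_of_mem_erase hd)]
    exact iff_of_true rfl (ne_of_mem_erase hd)
  · refine sum_congr rfl fun c hc => ?_
    rw [sum_eq_single_of_mem b (mem_compl.2 hb), if_pos]
    · rw [hadj (mem_of_mem_erase hc) (mem_compl.2 hb)]
      exact iff_of_false (ne_of_mem_erase hc) (not_not.2 rfl)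
    · intro d hd hdb
      rw [if_neg]
      rw [hadj (mem_of_mem_erase hc) hd]
      exact fun h => ne_of_mem_erase hc (h.2 hdb)

theorem sum_inter_neighborFinset_of_card_inter_add_two [Finite α] [DecidableEq V]
    (hπ : IsJohnsonCover G e r π) (hr : 3 ≤ r) (hx : #x = e) (hy : #y = e)
    (hxy : #(x ∩ y) + 2 = e) (F : V → M) :
    ∑ z ∈ G.neighborFinset (π x) ∩ G.neighborFinset (π y), F z =
      ∑ a ∈ x \ y, ∑ b ∈ y \ x, F (π (exchange x a b)) := by
  have := Fintype.ofFinite α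
  have hadj {a b : α} (ha : a ∈ x) (hb : b ∈ xᶜ) :
      G.Adj (π (exchange x a b)) (π y) ↔ a ∉ y ∧ b ∈ y := by
    rw [hπ.exchange_adj_iff hx hy (by lia) ha (mem_compl.1 hb)]
    grind
  have hcompl : y \ x = {b ∈ xᶜ | b ∈ y} := by
    ext b
    simp only [mem_sdiff, mem_filter, mem_compl, and_comm]
  rw [hπ.sum_inter_neighborFinset (by lia) hx, sdiff_eq_filter, sum_filter, hcompl]
  refine sum_congr rfl fun a ha => ?_
  rw [sum_congr rfl fun b hb => if_congr (hadj ha hb) rfl rfl]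
  by_cases hay : a ∈ y <;> simp [hay, sum_filter]

end IsJohnsonCover

end JohnsonCover

section SignedCover

variable {V α : Type*} [Fintype V] [DecidableEq α] {G : SimpleGraph V}
  [DecidableRel G.Adj] {e r p q : ℕ} {π : Finset α → V} {S : Matrix V V ℤ} {x : Finset α} {a b : α}

namespace IsJohnsonCover

theorem mul_adjMatrix_apply_insert_insert [Finite α] (hπ : IsJohnsonCover G e r π) (hr : 3 ≤ r)
    (hS : IsTriangleRegularSigning G S p q) {C : Finset α} (hC : #C + 2 = e) {a b c d : α}
    (ha : a ∉ C) (hb : b ∉ C) (hc : c ∉ C) (hd : d ∉ C) (hab : a ≠ b) (hac : a ≠ c) (had : a ≠ d)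
    (hbc : b ≠ c) (hbd : b ≠ d) (hcd : c ≠ d) :
    (S * G.adjMatrix ℤ) (π (insert a (insert b C))) (π (insert c (insert d C))) =
      ∑ i ∈ {c, d}, S (π (insert a (insert b C))) (π (insert i (insert b C))) +
        ∑ i ∈ {c, d}, S (π (insert b (insert a C))) (π (insert i (insert a C))) := by
  classical
  have hcard {i j : α} (hi : i ∉ C) (hj : j ∉ C) (hij : i ≠ j) :
      #(insert i (insert j C)) = e := by
    rw [card_insert_of_notMem (by grind), card_insert_of_notMem hj, ← hC]
  have hinter : insert a (insert b C) ∩ insert c (insert d C) = C := by grind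
  have hleft : insert a (insert b C) \ insert c (insert d C) = {a, b} := by grind
  have hright : insert c (insert d C) \ insert a (insert b C) = {c, d} := by grind
  rw [hS.mul_adjMatrix_apply_eq_sum, hπ.sum_inter_neighborFinset_of_card_inter_add_two hr
    (hcard ha hb hab) (hcard hc hd hcd) (by rw [hinter, hC]), hleft, hright, sum_pair hab]
  congr 1
  · simp only [exchange_insert_self (show a ∉ insert b C by grind)]
  · rw [insert_comm a b]
    simp only [exchange_insert_self (show b ∉ insert a C by grind)]

variable [Fintype α]

theorem three_mul_add_add_two_eq_card (hπ : IsJohnsonCover G e r π) (hr : 2 ≤ r) (he : 0 < e)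
    (hcard : e < Fintype.card α) (hS : IsTriangleRegularSigning G S p q) :
    3 * p + q + 2 = Fintype.card α := by
  classical
  obtain ⟨x, -, hx⟩ := exists_subset_card_eq (s := (univ : Finset α)) hcard.le
  have hcompl := card_add_card_compl x
  obtain ⟨a, ha⟩ := card_pos.1 (hx ▸ he)
  obtain ⟨b, hb⟩ := card_pos.1 (show 0 < #xᶜ by lia)
  have hb' := mem_compl.1 hb
  have h := hπ.sum_inter_neighborFinset_exchange hr hx ha hb' fun _ => 1
  simp only [← card_eq_sum_ones, hS.card_inter_neighborFinset
    (hπ.adj_exchange (by lia) hx ha hb'), card_erase_of_mem ha, card_erase_of_mem hb] at h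
  lia

theorem sum_apply_exchange_eq_zero (hπ : IsJohnsonCover G e r π) (hr : 2 ≤ r)
    (hS : IsTriangleRegularSigning G S p q) (hcard : 2 * e ≤ Fintype.card α) (hx : #x = e)
    (ha : a ∈ x) : ∑ b ∈ xᶜ, S (π x) (π (exchange x a b)) = 0 := by
  classical
  have hsum : ∑ b ∈ xᶜ, ∑ c ∈ x, S (π x) (π (exchange x c b)) = 0 := by
    rw [sum_comm, ← hπ.sum_neighborFinset hr hx, ← hS.sum_row (π x)]
    refine sum_subset (subset_univ _) fun z _ hz => hS.apply_eq_zero fun h => hz ?_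
    exact (G.mem_neighborFinset _ _).2 h
  have hlocal (b : α) (hb : b ∈ xᶜ) :
      ∑ d ∈ xᶜ, S (π x) (π (exchange x a d)) + ∑ c ∈ x, S (π x) (π (exchange x c b)) =
        (p - q + 2) * S (π x) (π (exchange x a b)) := by
    have hb' := mem_compl.1 hb
    have h := hS.mul_adjMatrix_apply (hπ.adj_exchange (by lia) hx ha hb')
    rw [hS.mul_adjMatrix_apply_eq_sum, hπ.sum_inter_neighborFinset_exchange hr hx ha hb',
      sum_erase_eq_sub hb, sum_erase_eq_sub ha] at h
    linarith
  have hmul : (#xᶜ - (p - q + 2) : ℤ) * ∑ b ∈ xᶜ, S (π x) (π (exchange x a b)) = 0 := by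
    have h := sum_congr rfl hlocal
    rw [sum_add_distrib, hsum, sum_const, nsmul_eq_mul, ← mul_sum] at h
    linarith
  have hcompl := card_add_card_compl x
  have hpos := card_pos.2 ⟨a, ha⟩
  have := hπ.three_mul_add_add_two_eq_card hr (by lia) (by lia) hS
  have := hS.pos
  exact (mul_eq_zero.1 hmul).resolve_left (by lia)

theorem isBalancedTriangularSigning (hπ : IsJohnsonCover G e r π) (hr : 3 ≤ r)
    (hS : IsTriangleRegularSigning G S p q) (hcard : 2 * e ≤ Fintype.card α) {C : Finset α}
    (hC : #C + 2 = e) : IsBalancedTriangularSigning Cᶜ fun b a c =>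
      S (π (insert a (insert b C))) (π (insert c (insert b C))) := by
  have hcard_insert {a b : α} (ha : a ∉ C) (hb : b ∉ C) (hab : a ≠ b) :
      #(insert a (insert b C)) = e := by
    rw [card_insert_of_notMem (by grind), card_insert_of_notMem hb, ← hC]
  have hexchange {a b : α} (ha : a ∉ C) (hab : a ≠ b) (c : α) :
      exchange (insert a (insert b C)) a c = insert c (insert b C) :=
    exchange_insert_self (by grind)
  refine ⟨fun b a c => hS.apply_swap _ _, ?_, ?_, ?_⟩ <;> simp only [mem_compl]
  · intro a b c ha hb hc hab hbc hac
    rw [← hexchange ha hab c]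
    exact hS.apply_eq_one_or (hπ.adj_exchange (by lia) (hcard_insert ha hb hab)
      (mem_insert_self _ _) (by grind))
  · intro a b ha hb hab
    rw [← hπ.sum_apply_exchange_eq_zero (by lia) hS hcard (hcard_insert ha hb hab)
      (mem_insert_self _ _)]
    refine sum_congr ?_ fun c _ => by rw [hexchange ha hab]
    ext c
    simp only [mem_sdiff, mem_compl, mem_insert, mem_singleton]
    tauto
  · intro a b c d ha hb hc hd hab hac had hbc hbd hcd
    have hskew := hS.mul_adjMatrix_apply_swap (π (insert a (insert b C)))
      (π (insert c (insert d C)))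
    rw [hπ.mul_adjMatrix_apply_insert_insert hr hS hC ha hb hc hd hab hac had hbc hbd hcd,
      hπ.mul_adjMatrix_apply_insert_insert hr hS hC hc hd ha hb hcd hac.symm hbc.symm had.symm
        hbd.symm hab, sum_pair hcd, sum_pair hcd, sum_pair hab, sum_pair hab] at hskew
    linarith

theorem apply_exchange_add_apply_exchange (hπ : IsJohnsonCover G e r π) (hr : 3 ≤ r) (he : 3 ≤ e)
    (hS : IsTriangleRegularSigning G S p q) (hcard : 2 * e ≤ Fintype.card α) (hx : #x = e)
    (ha : a ∈ x) (hb : b ∈ x) (hab : a ≠ b) {c : α} (hc : c ∉ x) :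
    S (π x) (π (exchange x a c)) + S (π x) (π (exchange x b c)) = 0 := by
  have hC : #((x.erase a).erase b) + 2 = e := by
    have := card_erase_add_one (mem_erase.2 ⟨hab.symm, hb⟩)
    have := card_erase_add_one ha
    lia
  have hs : 5 ≤ #((x.erase a).erase b)ᶜ := by
    rw [card_compl]
    lia
  have h := (hπ.isBalancedTriangularSigning hr hS hcard hC).apply_add_apply_swap hs
    (a := a) (b := b) (c := c) (by simp) (by simp) (by simp [hc]) hab (by grind) (by grind)
  have hb_insert : insert b ((x.erase a).erase b) = x.erase a :=
    insert_erase (mem_erase.2 ⟨hab.symm, hb⟩)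
  have ha_insert : insert a ((x.erase a).erase b) = x.erase b := by
    rw [erase_right_comm, insert_erase (mem_erase.2 ⟨hab, ha⟩)]
  rw [hb_insert, ha_insert, insert_erase ha, insert_erase hb, add_comm] at h
  exact h

theorem not_isTriangleRegularSigning (hπ : IsJohnsonCover G e r π) (hr : 3 ≤ r) (he : 3 ≤ e)
    (hcard : 2 * e ≤ Fintype.card α) : ¬ IsTriangleRegularSigning G S p q := by
  intro hS
  obtain ⟨x, -, hx⟩ := exists_subset_card_eq (s := (univ : Finset α)) (n := e)
    (by rw [card_univ]; lia)
  obtain ⟨a, ha, b, hb, c, hc, hab, hac, hbc⟩ := two_lt_card.1 (show 2 < #x by lia)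
  obtain ⟨d, hd⟩ := card_pos.1 (show 0 < #xᶜ by rw [card_compl]; lia)
  rw [mem_compl] at hd
  have hsum {i j : α} (hi : i ∈ x) (hj : j ∈ x) (hij : i ≠ j) :=
    hπ.apply_exchange_add_apply_exchange hr he hS hcard hx hi hj hij hd
  have := hsum ha hb hab
  have := hsum ha hc hac
  have := hsum hb hc hbc
  have := hS.apply_eq_one_or (hπ.adj_exchange (by lia) hx ha hd)
  lia

end IsJohnsonCover

end SignedCover

/-! ### Strongly regular graphs -/

section StronglyRegular

theorem card_commonNeighbors {V : Type*} [Fintype V] [DecidableEq V] (G : SimpleGraph V)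
    [DecidableRel G.Adj] (v w : V) :
    Fintype.card (G.commonNeighbors v w) = #(G.neighborFinset v ∩ G.neighborFinset w) := by
  rw [← Set.toFinset_card]
  congr 1
  ext u
  simp only [Set.mem_toFinset, SimpleGraph.mem_commonNeighbors, mem_inter,
    SimpleGraph.mem_neighborFinset]

variable {V : Type*} [Fintype V] {G : SimpleGraph V} [DecidableRel G.Adj] {S : Matrix V V ℤ}
  {p q n k ℓ μ : ℕ}

namespace IsTriangleRegularSigning

theorem trace_mul_self (hS : IsTriangleRegularSigning G S p q)
    (hG : G.IsRegularOfDegree k) : trace (S * S) = -(Fintype.card V * k) := by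
  have hdiag (x : V) : (S * S) x x = -k := by
    rw [mul_apply, ← hG x, ← G.card_neighborFinset_eq_degree, card_eq_sum_ones]
    simp only [hS.apply_swap x, mul_neg, hS.mul_self_apply, sum_neg_distrib]
    simp [SimpleGraph.neighborFinset_eq_filter]
  simp only [trace, diag_apply, hdiag, sum_const, card_univ, nsmul_eq_mul, mul_neg]

theorem trace_mul_mul_adjMatrix (hS : IsTriangleRegularSigning G S p q) :
    trace (S * (S * G.adjMatrix ℤ)) = (p - q) * trace (S * S) := by
  simp only [trace, diag_apply, mul_apply (M := S) (N := S * _), mul_apply (M := S) (N := S),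
    mul_sum]
  refine sum_congr rfl fun x _ => sum_congr rfl fun y _ => ?_
  by_cases h : G.Adj y x
  · rw [hS.mul_adjMatrix_apply h, mul_left_comm]
  · rw [hS.apply_swap y, hS.apply_eq_zero h, neg_zero, zero_mul, zero_mul, mul_zero]

theorem mul_adjMatrix_sq [DecidableEq V] (hS : IsTriangleRegularSigning G S p q)
    (hG : G.IsSRGWith n k ℓ μ) :
    S * G.adjMatrix ℤ ^ 2 = (k - μ : ℤ) • S + (ℓ - μ : ℤ) • (S * G.adjMatrix ℤ) := by
  have hJ : S * of 1 = 0 := by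
    ext x y
    simp only [mul_apply, of_apply, Pi.one_apply, mul_one, hS.sum_row, Matrix.zero_apply]
  have hcompl : Gᶜ.adjMatrix ℤ = of 1 - 1 - G.adjMatrix ℤ := by
    rw [← G.one_add_adjMatrix_add_compl_adjMatrix_eq_of_one (α := ℤ),
      G.compl_adjMatrix_eq_adjMatrix_compl ℤ]
    abel
  rw [hG.matrix_eq, hcompl, mul_add, mul_add, mul_smul_comm, mul_smul_comm, mul_smul_comm,
    mul_sub, mul_sub, hJ, mul_one]
  module

theorem mul_two_smul_adjMatrix_sub_sq [DecidableEq V]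
    (hS : IsTriangleRegularSigning G S p q) (hG : G.IsSRGWith n k ℓ μ) :
    S * ((2 : ℤ) • G.adjMatrix ℤ - (ℓ - μ : ℤ) • 1) ^ 2 =
      ((ℓ - μ) ^ 2 + 4 * (k - μ) : ℤ) • S := by
  have hexpand : ((2 : ℤ) • G.adjMatrix ℤ - (ℓ - μ : ℤ) • 1) ^ 2 =
      (4 : ℤ) • G.adjMatrix ℤ ^ 2 - (4 * (ℓ - μ) : ℤ) • G.adjMatrix ℤ +
        ((ℓ - μ) ^ 2 : ℤ) • (1 : Matrix V V ℤ) := by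
    rw [sq, sub_mul, mul_sub, mul_sub, smul_mul_smul, smul_mul_smul, smul_mul_smul,
      smul_mul_smul, ← sq (G.adjMatrix ℤ), one_mul, mul_one, one_mul]
    module
  rw [hexpand, mul_add, mul_sub, mul_smul_comm, mul_smul_comm, mul_smul_comm,
    hS.mul_adjMatrix_sq hG, mul_one]
  module

/-- Modulo `c` the matrix `S² (2N - (ℓ - μ))`, with `N` the adjacency matrix, squares to zero, so
its trace vanishes. -/
theorem dvd_of_isSRGWith (hS : IsTriangleRegularSigning G S p q) (hG : G.IsSRGWith n k ℓ μ)
    {c : ℕ} (hc : c.Prime) (h : (c : ℤ) ∣ (ℓ - μ) ^ 2 + 4 * (k - μ)) :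
    (c : ℤ) ∣ n * k * (2 * (p - q) - (ℓ - μ)) := by
  classical
  have := Fact.mk hc
  set B := (2 : ℤ) • G.adjMatrix ℤ - (ℓ - μ : ℤ) • (1 : Matrix V V ℤ) with hB
  have hcomm : Commute S B :=
    (hS.commute.smul_right _).sub_right ((Commute.one_right S).smul_right _)
  have hsq : (S ^ 2 * B) ^ 2 = ((ℓ - μ) ^ 2 + 4 * (k - μ) : ℤ) • S ^ 4 := by
    rw [(hcomm.pow_left 2).mul_pow, ← pow_mul, pow_succ S 3, mul_assoc,
      hS.mul_two_smul_adjMatrix_sub_sq hG, mul_smul_comm]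
  have htrace : trace (S ^ 2 * B) = -((n : ℤ) * k * (2 * (p - q) - (ℓ - μ))) := by
    rw [hB, mul_sub, mul_smul_comm, mul_smul_comm, mul_one, sq, mul_assoc, trace_sub, trace_smul,
      trace_smul, hS.trace_mul_mul_adjMatrix, hS.trace_mul_self hG.regular, hG.card]
    simp only [smul_eq_mul]
    ring
  have hnil : IsNilpotent ((Int.castRingHom (ZMod c)).mapMatrix (S ^ 2 * B)) := by
    refine ⟨2, ?_⟩
    rw [← map_pow, hsq, map_zsmul, ← Int.cast_smul_eq_zsmul (ZMod c),
      (ZMod.intCast_zmod_eq_zero_iff_dvd _ _).2 h, zero_smul]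
  have hzero := (isNilpotent_trace_of_isNilpotent hnil).eq_zero
  rw [RingHom.mapMatrix_apply, ← AddMonoidHom.map_trace, htrace, eq_intCast,
    ZMod.intCast_zmod_eq_zero_iff_dvd, dvd_neg] at hzero
  exact hzero

end IsTriangleRegularSigning

end StronglyRegular

/-! ### Johnson graphs and folded Johnson graphs as covers -/

section Johnson

theorem exists_isJohnsonCover_johnson {n e : ℕ} (hn : e ≤ n) (r : ℕ) :
    ∃ π : Finset (Fin n) → _, IsJohnsonCover (johnson n e) e r π := by
  obtain ⟨x₀, -, hx₀⟩ := exists_subset_card_eq (s := (univ : Finset (Fin n))) (n := e)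
    (by rwa [card_fin])
  refine ⟨fun x => if h : #x = e then ⟨x, h⟩ else ⟨x₀, hx₀⟩, ?_, ?_, ?_⟩
  · intro x y hx hy _
    rw [dif_pos hx, dif_pos hy]
    rfl
  · intro x y hx hy _ h
    rw [dif_pos hx, dif_pos hy] at h
    exact congrArg Subtype.val h
  · rintro x ⟨y, hy⟩ hx h
    rw [dif_pos hx] at h
    obtain ⟨a, ha, b, hb, rfl⟩ :=
      exists_exchange_eq (hy.trans hx.symm) ((show #(x ∩ y) + 1 = e from h).trans hx.symm)
    exact ⟨a, ha, b, hb, dif_pos hy⟩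

theorem card_inter_add_card_inter_compl {α : Type*} [Fintype α] [DecidableEq α]
    (x y : Finset α) : #(x ∩ y) + #(x ∩ yᶜ) = #x := by
  rw [← sdiff_eq_inter_compl, card_inter_add_card_sdiff]

variable {e : ℕ} {x y : Finset (Fin (2 * e))}

theorem card_compl_of_card_eq (hx : #x = e) : #xᶜ = e := by
  rw [card_compl, hx, Fintype.card_fin]
  lia

theorem nonempty_bisections (e : ℕ) :
    Nonempty {P : Finset (Finset (Fin (2 * e))) // ∃ x, #x = e ∧ P = {x, xᶜ}} := by
  obtain ⟨x, -, hx⟩ := exists_subset_card_eq (s := (univ : Finset (Fin (2 * e)))) (n := e)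
    (by rw [card_fin]; lia)
  exact ⟨⟨{x, xᶜ}, x, hx, rfl⟩⟩

/-- The partition `{x, xᶜ}` as a vertex of the folded Johnson graph `J̄(2e, e)`, with an arbitrary
value if `x` does not have `e` elements. -/
noncomputable def bisection (e : ℕ) (x : Finset (Fin (2 * e))) :
    {P : Finset (Finset (Fin (2 * e))) // ∃ x, #x = e ∧ P = {x, xᶜ}} :=
  if hx : #x = e then ⟨{x, xᶜ}, x, hx, rfl⟩ else Classical.choice (nonempty_bisections e)

theorem exists_bisection_eq
    (P : {P : Finset (Finset (Fin (2 * e))) // ∃ x, #x = e ∧ P = {x, xᶜ}}) :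
    ∃ x, #x = e ∧ bisection e x = P := by
  obtain ⟨P, x, hx, rfl⟩ := P
  exact ⟨x, hx, dif_pos hx⟩

theorem bisection_eq_iff (hx : #x = e) (hy : #y = e) :
    bisection e x = bisection e y ↔ x = y ∨ x = yᶜ := by
  rw [bisection, bisection, dif_pos hx, dif_pos hy, Subtype.mk.injEq]
  constructor
  · intro h
    have hxy : x ∈ ({y, yᶜ} : Finset (Finset _)) := h ▸ mem_insert_self _ _
    simpa only [mem_insert, mem_singleton] using hxy
  · rintro (rfl | rfl)
    · rfl
    · rw [compl_compl, pair_comm]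

theorem bisection_eq_iff_card_inter (hx : #x = e) (hy : #y = e) :
    bisection e x = bisection e y ↔ #(x ∩ y) = e ∨ #(x ∩ y) = 0 := by
  rw [bisection_eq_iff hx hy]
  constructor
  · rintro (rfl | rfl)
    · exact .inl (by rwa [inter_self])
    · exact .inr (by rw [inter_comm, inter_compl, card_empty])
  · rintro (h | h)
    · have hxy : x ∩ y = x := eq_of_subset_of_card_le inter_subset_left (by lia)
      exact .inl (eq_of_subset_of_card_le (inter_eq_left.1 hxy) (by lia))
    · have hdisj : Disjoint x y := disjoint_iff_inter_eq_empty.2 (card_eq_zero.1 h)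
      refine .inr (eq_of_subset_of_card_le (subset_compl_iff_disjoint_right.2 hdisj) ?_)
      rw [card_compl_of_card_eq hy, hx]

theorem foldedJohnson_adj_bisection_iff (he : 2 ≤ e) (hx : #x = e) (hy : #y = e) :
    (foldedJohnson e).Adj (bisection e x) (bisection e y) ↔ #(x ∩ y) = 1 ∨ #(x ∩ y) + 1 = e := by
  have hx_compl := card_compl_of_card_eq hx
  have h₁ := card_inter_add_card_inter_compl x y
  have h₂ := card_inter_add_card_inter_compl xᶜ y
  have h₃ := card_inter_add_card_inter_compl y x
  rw [inter_comm y x, inter_comm y] at h₃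
  constructor
  · rintro ⟨-, x', hx', y', hy', h⟩
    simp only [bisection, dif_pos hx, dif_pos hy, mem_insert, mem_singleton] at hx' hy'
    obtain rfl | rfl := hx' <;> obtain rfl | rfl := hy' <;> lia
  · intro h
    refine ⟨fun heq => ?_, x, ?_, y, ?_, h⟩
    · have := (bisection_eq_iff_card_inter hx hy).1 heq
      lia
    · simp only [bisection, dif_pos hx, mem_insert_self]
    · simp only [bisection, dif_pos hy, mem_insert_self]

theorem isJohnsonCover_bisection {r : ℕ} (hr : r + 2 ≤ e) :
    IsJohnsonCover (foldedJohnson e) e r (bisection e) := by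
  refine ⟨fun {x y} hx hy hxy => ?_, fun {x y} hx hy hxy h => ?_, fun {x P} hx h => ?_⟩
  · rw [foldedJohnson_adj_bisection_iff (by lia) hx hy]
    lia
  · refine ((bisection_eq_iff hx hy).1 h).resolve_right ?_
    rintro rfl
    rw [inter_comm, inter_compl, card_empty] at hxy
    lia
  · obtain ⟨y, hy, rfl⟩ := exists_bisection_eq P
    have hcard := card_inter_add_card_inter_compl x y
    obtain ⟨z, hz, hxz, hyz⟩ : ∃ z, #z = e ∧ #(x ∩ z) + 1 = e ∧ bisection e z = bisection e y := by
      obtain h | h := (foldedJohnson_adj_bisection_iff (by lia) hx hy).1 h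
      · have hy' := card_compl_of_card_eq hy
        exact ⟨yᶜ, hy', by lia, (bisection_eq_iff hy' hy).2 (.inr rfl)⟩
      · exact ⟨y, hy, h, rfl⟩
    obtain ⟨a, ha, b, hb, rfl⟩ := exists_exchange_eq (hz.trans hx.symm) (hxz.trans hx.symm)
    exact ⟨a, ha, b, hb, hyz⟩

end Johnson

section FoldedJohnsonFour

theorem card_inter_neighborFinset_bisection_four [DecidableRel (foldedJohnson 4).Adj]
    {x y : Finset (Fin (2 * 4))} (hx : #x = 4) (hy : #y = 4) (hxy : #(x ∩ y) = 2) :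
    #((foldedJohnson 4).neighborFinset (bisection 4 x) ∩
      (foldedJohnson 4).neighborFinset (bisection 4 y)) = 8 := by
  have hadj {a b : Fin (2 * 4)} (ha : a ∈ x) (hb : b ∈ xᶜ) :
      (foldedJohnson 4).Adj (bisection 4 (exchange x a b)) (bisection 4 y) ↔
        (b ∈ y ↔ a ∉ y) := by
    rw [mem_compl] at hb
    have h := card_exchange_inter ha hb y
    rw [foldedJohnson_adj_bisection_iff (by lia) ((card_exchange ha hb).trans hx) hy]
    grind
  have hinner (a : Fin (2 * 4)) (ha : a ∈ x) :
      (∑ b ∈ xᶜ, if (foldedJohnson 4).Adj (bisection 4 (exchange x a b)) (bisection 4 y)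
        then 1 else 0) = 2 := by
    have hx_compl := card_compl_of_card_eq hx
    have h₁ := card_inter_add_card_inter_compl xᶜ y
    have h₂ := card_inter_add_card_inter_compl y x
    rw [inter_comm y x, inter_comm y] at h₂
    rw [sum_congr rfl fun b hb => if_congr (hadj ha hb) rfl rfl, ← card_filter]
    by_cases hay : a ∈ y
    · have : {b ∈ xᶜ | b ∈ y ↔ a ∉ y} = xᶜ ∩ yᶜ := by
        ext b
        simp [hay]
      lia
    · have : {b ∈ xᶜ | b ∈ y ↔ a ∉ y} = xᶜ ∩ y := by
        ext b
        simp [hay]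
      lia
  rw [card_eq_sum_ones,
    (isJohnsonCover_bisection (r := 2) le_rfl).sum_inter_neighborFinset le_rfl hx,
    sum_congr rfl hinner, sum_const, hx, smul_eq_mul]

theorem exists_isSRGWith_foldedJohnson_four [DecidableRel (foldedJohnson 4).Adj] :
    ∃ n, 0 < n ∧ (foldedJohnson 4).IsSRGWith n 16 6 8 := by
  have hπ := isJohnsonCover_bisection (e := 4) (r := 2) le_rfl
  refine ⟨_, Fintype.card_pos_iff.2 (nonempty_bisections 4), rfl, fun P => ?_, fun P Q h => ?_,
    fun P Q hne h => ?_⟩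
  · obtain ⟨x, hx, rfl⟩ := exists_bisection_eq P
    rw [← SimpleGraph.card_neighborFinset_eq_degree, card_eq_sum_ones,
      hπ.sum_neighborFinset le_rfl hx]
    simp only [sum_const, hx, card_compl_of_card_eq hx, smul_eq_mul]
  · obtain ⟨x, hx, rfl⟩ := exists_bisection_eq P
    obtain ⟨a, ha, b, hb, rfl⟩ := hπ.exists_exchange hx h
    rw [card_commonNeighbors, card_eq_sum_ones,
      hπ.sum_inter_neighborFinset_exchange le_rfl hx ha hb, sum_const, sum_const,
      card_erase_of_mem ha, card_erase_of_mem (mem_compl.2 hb), hx, card_compl_of_card_eq hx]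
    rfl
  · obtain ⟨x, hx, rfl⟩ := exists_bisection_eq P
    obtain ⟨y, hy, rfl⟩ := exists_bisection_eq Q
    have hle := card_le_card (inter_subset_left (s₁ := x) (s₂ := y))
    rw [ne_eq, bisection_eq_iff_card_inter hx hy] at hne
    rw [foldedJohnson_adj_bisection_iff (by lia) hx hy] at h
    rw [card_commonNeighbors]
    exact card_inter_neighborFinset_bisection_four hx hy (by lia)

theorem isSRGWith_foldedJohnson_four [DecidableRel (foldedJohnson 4).Adj] :
    (foldedJohnson 4).IsSRGWith 35 16 6 8 := by
  obtain ⟨n, hn, h⟩ := exists_isSRGWith_foldedJohnson_four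
  have := h.param_eq _ hn
  rwa [show n = 35 by lia] at h

theorem not_isTriangleRegularSigning_foldedJohnson_four [DecidableRel (foldedJohnson 4).Adj]
    {S : Matrix _ _ ℤ} {p q : ℕ} : ¬ IsTriangleRegularSigning (foldedJohnson 4) S p q := by
  intro hS
  have hpq : 3 * p + q + 2 = 2 * 4 := by
    rw [(isJohnsonCover_bisection (e := 4) (r := 2) le_rfl).three_mul_add_add_two_eq_card le_rfl
      (by lia) (by rw [Fintype.card_fin]; lia) hS, Fintype.card_fin]
  have hdvd := hS.dvd_of_isSRGWith isSRGWith_foldedJohnson_four Nat.prime_three (by norm_num)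
  have hq := hS.pos
  lia

end FoldedJohnsonFour

theorem not_isTriangleRegularSigning_johnson {n e : ℕ} (he : 3 ≤ e) (hn : 2 * e ≤ n)
    [DecidableRel (johnson n e).Adj] {S : Matrix _ _ ℤ} {p q : ℕ} :
    ¬ IsTriangleRegularSigning (johnson n e) S p q := by
  obtain ⟨π, hπ⟩ := exists_isJohnsonCover_johnson (show e ≤ n by lia) 3
  exact hπ.not_isTriangleRegularSigning le_rfl he (by rwa [Fintype.card_fin])

theorem not_isTriangleRegularSigning_foldedJohnson {e : ℕ} (he : 4 ≤ e)
    [DecidableRel (foldedJohnson e).Adj] {S : Matrix _ _ ℤ} {p q : ℕ} :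
    ¬ IsTriangleRegularSigning (foldedJohnson e) S p q := by
  obtain rfl | he := he.eq_or_lt
  · exact not_isTriangleRegularSigning_foldedJohnson_four
  · exact (isJohnsonCover_bisection (r := 3) he).not_isTriangleRegularSigning le_rfl (by lia)
      (by rw [Fintype.card_fin])

section Main

variable {V : Type*} [Finite V] {Γ : Digraph V}

theorem isEmpty_iso_johnson (hΓ : IsCommWeaklyDistanceRegular Γ) (hT : arcTypes Γ = {3})
    {n e : ℕ} (he : 3 ≤ e) (hn : 2 * e ≤ n) :
    IsEmpty (Γ.toSimpleGraphInclusive ≃g johnson n e) := by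
  classical
  have := Fintype.ofFinite V
  obtain ⟨S, p, q, hS⟩ := hΓ.exists_isTriangleRegularSigning hT
  exact ⟨fun φ => not_isTriangleRegularSigning_johnson he hn (hS.reindex φ)⟩

theorem isEmpty_iso_foldedJohnson (hΓ : IsCommWeaklyDistanceRegular Γ) (hT : arcTypes Γ = {3})
    {e : ℕ} (he : 4 ≤ e) : IsEmpty (Γ.toSimpleGraphInclusive ≃g foldedJohnson e) := by
  classical
  have := Fintype.ofFinite V
  obtain ⟨S, p, q, hS⟩ := hΓ.exists_isTriangleRegularSigning hT
  exact ⟨fun φ => not_isTriangleRegularSigning_foldedJohnson he (hS.reindex φ)⟩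

end Main

end WDRD

theorem proposition5p1 {V : Type*} [Finite V] (Γ : Digraph V)
    (hΓ : WDRD.IsCommWeaklyDistanceRegular Γ) (m e : ℕ)
    (hJ : (2 ≤ e ∧ 2 * e ≤ m ∧
            Nonempty (Γ.toSimpleGraphInclusive ≃g WDRD.johnson m e)) ∨
          (4 ≤ e ∧ m = 2 * e ∧
            Nonempty (Γ.toSimpleGraphInclusive ≃g WDRD.foldedJohnson e)))
    (hT : WDRD.arcTypes Γ = {3}) :
    Nonempty (Γ.toSimpleGraphInclusive ≃g WDRD.johnson m 2) ∧
      (∀ n' e' : ℕ, 2 < e' → 2 * e' ≤ n' →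
        IsEmpty (Γ.toSimpleGraphInclusive ≃g WDRD.johnson n' e')) ∧
      (∀ e' : ℕ, 4 ≤ e' →
        IsEmpty (Γ.toSimpleGraphInclusive ≃g WDRD.foldedJohnson e')) := by
  refine ⟨?_, fun n' e' he' hn' => WDRD.isEmpty_iso_johnson hΓ hT he' hn',
    fun e' he' => WDRD.isEmpty_iso_foldedJohnson hΓ hT he'⟩
  rcases hJ with ⟨he, hm, hφ⟩ | ⟨he, -, ⟨φ⟩⟩
  · rcases he.eq_or_lt with rfl | he
    · exact hφ
    · exact ((WDRD.isEmpty_iso_johnson hΓ hT he hm).false hφ.some).elim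
  · exact ((WDRD.isEmpty_iso_foldedJohnson hΓ hT he).false φ).elim
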